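/- For a complex polynomial $f(x)=a\prod_{n}(x-\gamma_n)$ let $\mu(f)=|a|\prod_n\max\{1,|\gamma_n|\}$ be its Mahler measure ($\mu(0)=0$), extended to Laurent polynomials by $\mu(x^{-n}f)=\mu(f)$, and let $\rho(f)=\mu\bigl(f(x+1/x)\bigr)$ be the reciprocal Mahler measure of $f\in\mathbb{C}[x]$. For $J\ge 0$ let $$\mathcal{U}_J(\rho)=\Bigl\{(a_1,\dots,a_{J+1})\in\mathbb{R}^{J+1} : \rho\Bigl(\sum_{n=1}^{J+1}a_n x^{J+1-n}\Bigr)\le 1\Bigr\},$$ and let $\lambda_{J+1}$ be Lebesgue measure on $\mathbb{R}^{J+1}$. A polynomial $f$ of degree $M$ is called reciprocal if $f(x)=x^M f(1/x)$ (the zero polynomial is counted as reciprocal). For $T\in\mathbb{R}$ let $\mathcal{M}_N(T)$ be the set of reciprocal polynomials $f\in\mathbb{Z}[x]$ with $\deg f\le N$ and $\mu(f)\le T$. Let $N$ be a positive integer. Then every set $\mathcal{M}_N(T)$ is finite, every volume $\lambda_{J+1}(\mathcal{U}_J(\rho))$, $J\ge 0$, is finite, and, as $T\to\infty$, $$\#\mathcal{M}_N(T)=\begin{cases}\lambda_{J+1}(\mathcal{U}_J(\rho))\,T^{J+1}+O(T^J)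 & \text{if } N=2J,\\ 2\,\lambda_{J+1}(\mathcal{U}_J(\rho))\,T^{J+1}+O(T^J) & \text{if } N=2J+1,\end{cases}$$ where the constant implicit in the $O$-notation depends on $J$. -/

import Mathlib

open Polynomial Filter Asymptotics MeasureTheory

noncomputable section

namespace ReciprocalMahler

/-- Mahler's measure of a complex Laurent polynomial `g`: the Mahler measure of a polynomial `p`
with `p = x ^ n * g`, that is, the multiplicative extension with value `1` at `x⁻¹`.
It does not depend on the choice of `n` and `p`, see `laurentMahlerMeasure_eq`. -/
def laurentMahlerMeasure (g : LaurentPolynomial ℂ) : ℝ :=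
  (g.exists_T_pow.choose_spec.choose).mahlerMeasure

theorem laurentMahlerMeasure_eq {g : LaurentPolynomial ℂ} {n : ℕ} {p : ℂ[X]}
    (h : p.toLaurent = g * LaurentPolynomial.T n) :
    laurentMahlerMeasure g = p.mahlerMeasure := by
  have h' := g.exists_T_pow.choose_spec.choose_spec
  unfold laurentMahlerMeasure
  generalize g.exists_T_pow.choose_spec.choose = q at *
  generalize g.exists_T_pow.choose = m at *
  have hX : ∀ k : ℕ, ((X : ℂ[X]) ^ k).mahlerMeasure = 1 := by
    intro k
    simp [mahlerMeasure, logMahlerMeasure_monomial, ← monomial_one_right_eq_X_pow]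
  have key : q * X ^ n = p * X ^ m := by
    apply toLaurent_injective
    rw [map_mul, map_mul, toLaurent_X_pow, toLaurent_X_pow, h, h', mul_right_comm]
  have := congrArg mahlerMeasure key
  simpa [mahlerMeasure_mul, hX] using this

/-- The reciprocal Mahler measure: `ρ(f) = μ(f(x + 1/x))`. -/
def rho (f : ℂ[X]) : ℝ :=
  laurentMahlerMeasure (aeval (LaurentPolynomial.T 1 + LaurentPolynomial.T (-1)) f)

/-- The polynomial `∑ i, a i * x ^ (N - i)` with coefficient vector `a`, leading term first. -/
def ofCoeffs {N : ℕ} (a : Fin (N + 1) → ℂ) : ℂ[X] :=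
  ∑ i : Fin (N + 1), C (a i) * X ^ (N - (i : ℕ))

/-- The degree `N` real unit star body of `Φ`. -/
def realUnitStarBody (Φ : ℂ[X] → ℝ) (N : ℕ) : Set (Fin (N + 1) → ℝ) :=
  {a | Φ (ofCoeffs fun i => (a i : ℂ)) ≤ 1}

/-- `f` is reciprocal if `f(x) = x ^ M * f(1/x)`, where `M` is the degree of `f`. -/
def IsReciprocal (f : ℤ[X]) : Prop := f.reverse = f

/-- The reciprocal integer polynomials of degree at most `N` and Mahler measure at most `t`. -/
def recipPolys (N : ℕ) (t : ℝ) : Set ℤ[X] :=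
  {f | IsReciprocal f ∧ f.natDegree ≤ N ∧ (f.map (Int.castRingHom ℂ)).mahlerMeasure ≤ t}

end ReciprocalMahler

end

/-! A reciprocal polynomial of even degree `2m` is uniquely `x ^ m * g(x + 1/x)` with `g` integral
of degree `m`, and its Mahler measure is `rho g` (`bijOn_recipLift`). A reciprocal polynomial of odd
degree vanishes at `-1`, and dividing by `X + 1`, which has measure one, leaves a reciprocal
polynomial of even degree. So the count reduces to integer polynomials with `rho ≤ t`
(`ncard_recipPolys`), that is, to points of `t⁻¹ ℤ ^ (J + 1)` in the star body.

Each cell of that lattice is charged by its lower corner. Only cells meeting the boundary spoil the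
comparison with the volume, and `O(t ^ J)` of them do if the level set `rho = 1` is `J`-dimensional
in the sense of `HasCover` (`HasCover.lattice_count`). This is shown by parametrisation: `rho` is
multiplicative, so a real polynomial with `rho = 1` is a product of factors of degree at most two
with `rho = 1`, and the Joukowski map writes these factors as polynomial images of cubes
(`sphere_one`, `sphere_two`, `hasCover_sphere`). The same parametrisation makes the level set
compact; with homogeneity this gives boundedness of the star body and separation by its boundary,
without using continuity of `rho`. -/

noncomputable section

namespace ReciprocalMahler

/-! ### Covering numbers of compact sets -/

section Cover

variable {E F : Type*}

/-- A compact set that, for every `n ≥ 1`, is covered by `O(n ^ k)` balls of radius `O(1 / n)`. -/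
def HasCover [PseudoMetricSpace E] (k : ℕ) (A : Set E) : Prop :=
  IsCompact A ∧ ∃ C : ℕ, ∀ n : ℕ, 0 < n → ∃ S : Finset E, S.card ≤ C * n ^ k ∧
    ∀ a ∈ A, ∃ p ∈ S, dist a p ≤ C / n

theorem HasCover.of_finite [PseudoMetricSpace E] {A : Set E} (hA : A.Finite) : HasCover 0 A :=
  ⟨hA.isCompact, hA.toFinset.card, fun n _ => ⟨hA.toFinset, by simp, fun a ha =>
    ⟨a, by simpa using ha, by rw [dist_self]; positivity⟩⟩⟩

theorem hasCover_Icc : HasCover 1 (Set.Icc (-1 : ℝ) 1) := by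
  refine ⟨isCompact_Icc, 3, fun n hn =>
    ⟨(Finset.Icc (-n : ℤ) n).image fun i : ℤ => (i / n : ℝ), ?_, ?_⟩⟩
  · refine Finset.card_image_le.trans ?_
    simp only [Int.card_Icc, pow_one]
    omega
  · rintro a ⟨h1, h2⟩
    have hn' : (0 : ℝ) < n := by exact_mod_cast hn
    refine ⟨(⌊a * n⌋ / n : ℝ), Finset.mem_image.2 ⟨_, Finset.mem_Icc.2 ⟨?_, ?_⟩, rfl⟩, ?_⟩
    · rw [Int.le_floor]; push_cast; nlinarith
    · rw [← Int.cast_le (R := ℝ)]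
      refine (Int.floor_le _).trans ?_
      push_cast; nlinarith
    · have e : a - ⌊a * n⌋ / n = (a * n - ⌊a * n⌋) / n := by field_simp
      rw [Real.dist_eq, e, abs_div, abs_of_pos hn']
      gcongr
      rw [abs_le]
      have h3 := Int.floor_le (a * n)
      have h4 := Int.lt_floor_add_one (a * n)
      constructor <;> push_cast <;> linarith

theorem HasCover.union [PseudoMetricSpace E] {k : ℕ} {A B : Set E} (hA : HasCover k A)
    (hB : HasCover k B) : HasCover k (A ∪ B) := by
  classical
  obtain ⟨hA, C, hC⟩ := hA
  obtain ⟨hB, D, hD⟩ := hB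
  refine ⟨hA.union hB, C + D, fun n hn => ?_⟩
  obtain ⟨S, hS, hS'⟩ := hC n hn
  obtain ⟨T, hT, hT'⟩ := hD n hn
  refine ⟨S ∪ T, (Finset.card_union_le _ _).trans (by linarith), ?_⟩
  rintro a (ha | ha)
  · obtain ⟨p, hp, h⟩ := hS' a ha
    exact ⟨p, Finset.mem_union_left _ hp, h.trans (by gcongr; simp)⟩
  · obtain ⟨p, hp, h⟩ := hT' a ha
    exact ⟨p, Finset.mem_union_right _ hp, h.trans (by gcongr; simp)⟩

theorem HasCover.prod [PseudoMetricSpace E] [PseudoMetricSpace F] {j k : ℕ} {A : Set E} {B : Set F}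
    (hA : HasCover j A) (hB : HasCover k B) : HasCover (j + k) (A ×ˢ B) := by
  obtain ⟨hA, C, hC⟩ := hA
  obtain ⟨hB, D, hD⟩ := hB
  refine ⟨hA.prod hB, C * D + C + D, fun n hn => ?_⟩
  obtain ⟨S, hS, hS'⟩ := hC n hn
  obtain ⟨T, hT, hT'⟩ := hD n hn
  refine ⟨S ×ˢ T, ?_, ?_⟩
  · rw [Finset.card_product]
    calc S.card * T.card ≤ (C * n ^ j) * (D * n ^ k) := Nat.mul_le_mul hS hT
      _ = C * D * n ^ (j + k) := by ring
      _ ≤ _ := by gcongr; omega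
  · rintro ⟨a, b⟩ ⟨ha, hb⟩
    obtain ⟨p, hp, h⟩ := hS' a ha
    obtain ⟨q, hq, h'⟩ := hT' b hb
    refine ⟨(p, q), Finset.mk_mem_product hp hq, max_le (h.trans ?_) (h'.trans ?_)⟩ <;> gcongr <;>
      nlinarith [Nat.zero_le (C * D)]

/-- A `C¹` map is only locally Lipschitz; compactness of `A`, carried along in `HasCover`, makes it
Lipschitz on `A`. -/
theorem HasCover.image [NormedAddCommGroup E] [NormedSpace ℝ E] [NormedAddCommGroup F]
    [NormedSpace ℝ F] {k : ℕ} {A : Set E} (hA : HasCover k A) {f : E → F} (hf : ContDiff ℝ 1 f) :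
    HasCover k (f '' A) := by
  classical
  obtain ⟨hA, C, hC⟩ := hA
  refine ⟨hA.image hf.continuous, ?_⟩
  obtain ⟨K, hK⟩ :=
    (hf.locallyLipschitz.locallyLipschitzOn (s := A)).exists_lipschitzOnWith_of_compact hA
  -- choose the centres inside `A`, where `f` is Lipschitz
  have key : ∀ n : ℕ, 0 < n → ∃ S : Finset E, ↑S ⊆ A ∧ S.card ≤ C * n ^ k ∧
      ∀ a ∈ A, ∃ p ∈ S, dist a p ≤ 2 * C / n := by
    intro n hn
    obtain ⟨S, hS, hS'⟩ := hC n hn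
    by_cases hne : A.Nonempty
    · obtain ⟨a₀, ha₀⟩ := hne
      have : ∀ p : E, ∃ q ∈ A, (∃ a ∈ A, dist a p ≤ C / n) → dist q p ≤ C / n := by
        intro p
        by_cases h : ∃ a ∈ A, dist a p ≤ C / n
        · obtain ⟨a, ha, h⟩ := h
          exact ⟨a, ha, fun _ => h⟩
        · exact ⟨a₀, ha₀, fun h' => absurd h' h⟩
      choose g hg hg' using this
      refine ⟨S.image g, ?_, Finset.card_image_le.trans hS, fun a ha => ?_⟩
      · intro x hx
        obtain ⟨p, -, rfl⟩ := Finset.mem_image.1 (Finset.mem_coe.1 hx)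
        exact hg p
      · obtain ⟨p, hp, h⟩ := hS' a ha
        refine ⟨g p, Finset.mem_image_of_mem _ hp, ?_⟩
        have := dist_triangle_right a (g p) p
        have := hg' p ⟨a, ha, h⟩
        have e : 2 * (C : ℝ) / n = C / n + C / n := by ring
        linarith
    · rw [Set.not_nonempty_iff_eq_empty] at hne
      exact ⟨∅, by simp, by simp, by simp [hne]⟩
  obtain ⟨L, hL⟩ := exists_nat_ge (K : ℝ)
  refine ⟨C + L * (2 * C), fun n hn => ?_⟩
  obtain ⟨S, hSA, hS, hS'⟩ := key n hn
  refine ⟨S.image f, Finset.card_image_le.trans (hS.trans (by gcongr; omega)), ?_⟩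
  rintro _ ⟨a, ha, rfl⟩
  obtain ⟨p, hp, h⟩ := hS' a ha
  refine ⟨f p, Finset.mem_image_of_mem _ hp, (hK.dist_le_mul a ha p (hSA hp)).trans ?_⟩
  calc (K : ℝ) * dist a p ≤ L * (2 * C / n) := by gcongr
    _ = (L * (2 * C)) / n := by ring
    _ ≤ _ := by gcongr; push_cast; linarith [Nat.cast_nonneg (α := ℝ) C]

end Cover

/-! ### Lattice points in bounded sets -/

section LatticePoints

variable {ι : Type*}

/-- The cell of the lattice `t⁻¹ ℤ ^ ι` with lower corner `t⁻¹ z`. -/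
def cell (t : ℝ) (z : ι → ℤ) : Set (ι → ℝ) :=
  Set.pi Set.univ fun i => Set.Ico (z i / t : ℝ) ((z i + 1) / t)

theorem mem_cell_iff {t : ℝ} (ht : 0 < t) {z : ι → ℤ} {x : ι → ℝ} :
    x ∈ cell t z ↔ ∀ i, ⌊t * x i⌋ = z i := by
  simp only [cell, Set.mem_univ_pi, Set.mem_Ico, Int.floor_eq_iff, div_le_iff₀ ht, lt_div_iff₀ ht,
    mul_comm t]

theorem corner_mem_cell {t : ℝ} (ht : 0 < t) (z : ι → ℤ) : (fun i => (z i / t : ℝ)) ∈ cell t z := by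
  rw [mem_cell_iff ht]
  intro i
  rw [mul_div_cancel₀ _ ht.ne', Int.floor_intCast]

theorem isPreconnected_cell (t : ℝ) (z : ι → ℤ) : IsPreconnected (cell t z) :=
  (convex_pi fun _ _ => convex_Ico _ _).isPreconnected

theorem measurableSet_cell [Fintype ι] (t : ℝ) (z : ι → ℤ) : MeasurableSet (cell t z) :=
  MeasurableSet.univ_pi fun _ => measurableSet_Ico

theorem volume_cell [Fintype ι] {t : ℝ} (z : ι → ℤ) :
    volume (cell t z) = ENNReal.ofReal t⁻¹ ^ Fintype.card ι := by
  rw [cell, Real.volume_pi_Ico]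
  have : ∀ i, ((z i + 1) / t - z i / t : ℝ) = t⁻¹ := fun i => by ring
  simp [this]

theorem pairwise_disjoint_cell {t : ℝ} (ht : 0 < t) :
    Pairwise (Function.onFun Disjoint (cell (ι := ι) t)) := by
  intro z w hzw
  refine Set.disjoint_left.2 fun x hx hx' => hzw ?_
  rw [mem_cell_iff ht] at hx hx'
  exact funext fun i => (hx i).symm.trans (hx' i)

/-- The number of cells meeting a set covered by `O(n ^ k)` balls of radius `O(1 / n)`. -/
theorem HasCover.exists_card_cell_le [Fintype ι] {k : ℕ} {K : Set (ι → ℝ)} (hK : HasCover k K) :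
    ∃ C : ℝ, ∀ t : ℝ, 1 ≤ t → ∃ B : Finset (ι → ℤ), (B.card : ℝ) ≤ C * t ^ k ∧
      ∀ z, (cell t z ∩ K).Nonempty → z ∈ B := by
  classical
  obtain ⟨-, C, hC⟩ := hK
  -- The cover is taken at scale `⌈t⌉₊ ≤ 2 * t`, whence `2 ^ k`. After scaling by `t` a ball has
  -- radius at most `C`, so floors differ from that of the centre by at most `C + 1`: `2 * C + 3`
  -- values per coordinate.
  refine ⟨C * 2 ^ k * (2 * C + 3) ^ Fintype.card ι, fun t ht => ?_⟩
  have ht0 : 0 < t := by linarith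
  obtain ⟨S, hS, hS'⟩ := hC ⌈t⌉₊ (Nat.ceil_pos.2 ht0)
  refine ⟨S.biUnion fun p => Fintype.piFinset fun i =>
    Finset.Icc (⌊t * p i⌋ - (C + 1)) (⌊t * p i⌋ + (C + 1)), ?_, ?_⟩
  · have h1 : (S.biUnion fun p => Fintype.piFinset fun i =>
        Finset.Icc (⌊t * p i⌋ - ((C : ℤ) + 1)) (⌊t * p i⌋ + (C + 1))).card ≤
        S.card * (2 * C + 3) ^ Fintype.card ι := by
      refine Finset.card_biUnion_le_card_mul _ _ _ fun p _ => ?_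
      rw [Fintype.card_piFinset]
      refine (Finset.prod_le_pow_card _ _ (2 * C + 3) fun i _ => ?_).trans (by simp)
      rw [Int.card_Icc]; omega
    have h2 : ((⌈t⌉₊ : ℕ) : ℝ) ≤ 2 * t := by
      have := Nat.ceil_lt_add_one ht0.le
      linarith
    calc _ ≤ ((S.card * (2 * C + 3) ^ Fintype.card ι : ℕ) : ℝ) := by exact_mod_cast h1
      _ = S.card * (2 * C + 3) ^ Fintype.card ι := by push_cast; ring
      _ ≤ (C * (2 * t) ^ k) * (2 * C + 3) ^ Fintype.card ι := by
        gcongr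
        calc (S.card : ℝ) ≤ C * (⌈t⌉₊ : ℝ) ^ k := by exact_mod_cast hS
          _ ≤ _ := by gcongr
      _ = _ := by rw [mul_pow]; ring
  · rintro z ⟨x, hx, hxK⟩
    obtain ⟨p, hp, h⟩ := hS' x hxK
    rw [mem_cell_iff ht0] at hx
    refine Finset.mem_biUnion.2 ⟨p, hp, Fintype.mem_piFinset.2 fun i => ?_⟩
    have h1 : |t * x i - t * p i| ≤ C := by
      have h2 : dist (x i) (p i) ≤ C / t :=
        ((dist_le_pi_dist x p i).trans h).trans (by gcongr; exact Nat.le_ceil t)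
      rw [Real.dist_eq, le_div_iff₀ ht0] at h2
      rwa [← mul_sub, abs_mul, abs_of_pos ht0, mul_comm]
    rw [abs_le] at h1
    have h3 := Int.floor_le (t * x i)
    have h4 := Int.lt_floor_add_one (t * x i)
    have h5 := Int.floor_le (t * p i)
    have h6 := Int.lt_floor_add_one (t * p i)
    rw [hx i] at h3 h4
    rw [Finset.mem_Icc]
    constructor
    · suffices h : (⌊t * p i⌋ : ℝ) - (C + 1) ≤ z i by exact_mod_cast h
      have : (⌊t * p i⌋ : ℝ) - (C + 1) < z i := by linarith
      exact this.le
    · suffices h : (z i : ℝ) ≤ ⌊t * p i⌋ + (C + 1) by exact_mod_cast h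
      linarith

theorem finite_setOf_corner_mem [Fintype ι] {A : Set (ι → ℝ)} (hA : Bornology.IsBounded A) {t : ℝ}
    (ht : 0 < t) : {z : ι → ℤ | (fun i => (z i / t : ℝ)) ∈ A}.Finite := by
  classical
  obtain ⟨R, hR⟩ := hA.subset_closedBall 0
  refine (Set.finite_Icc (fun _ : ι => -⌈R * t⌉) (fun _ => ⌈R * t⌉)).subset fun z hz => ?_
  have h : ∀ i, |(z i : ℝ)| ≤ R * t := by
    intro i
    have h1 := hR hz
    rw [mem_closedBall_zero_iff] at h1
    have h2 := (norm_le_pi_norm _ i).trans h1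
    rwa [Real.norm_eq_abs, abs_div, abs_of_pos ht, div_le_iff₀ ht] at h2
  have h' : ∀ i, |z i| ≤ ⌈R * t⌉ := fun i => by
    have := (h i).trans (Int.le_ceil _)
    exact_mod_cast this
  exact ⟨fun i => (abs_le.1 (h' i)).1, fun i => (abs_le.1 (h' i)).2⟩

/-- The number of points of the lattice `t⁻¹ ℤ ^ ι` in a bounded set `A` is
`vol(A) t ^ d + O(t ^ k)` if `A` is separated from its complement by a `k`-dimensional set. -/
theorem HasCover.lattice_count [Fintype ι] {k : ℕ} {A K : Set (ι → ℝ)} (hK : HasCover k K)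
    (hA : Bornology.IsBounded A)
    (hsep : ∀ Q : Set (ι → ℝ), IsPreconnected Q → (Q ∩ A).Nonempty → (Q ∩ Aᶜ).Nonempty →
      (Q ∩ K).Nonempty) :
    ∃ C : ℝ, ∀ t : ℝ, 1 ≤ t →
      |({z : ι → ℤ | (fun i => (z i / t : ℝ)) ∈ A}.ncard : ℝ) -
        (volume A).toReal * t ^ Fintype.card ι| ≤ C * t ^ k := by
  classical
  obtain ⟨C, hC⟩ := hK.exists_card_cell_le
  refine ⟨C, fun t ht => ?_⟩
  have ht0 : 0 < t := by linarith
  obtain ⟨B, hB, hB'⟩ := hC t ht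
  have hfin := finite_setOf_corner_mem hA ht0
  have htop : volume A ≠ ⊤ := hA.measure_lt_top.ne
  set L : Finset (ι → ℤ) := hfin.toFinset with hL
  have hmemL : ∀ z, z ∈ L ↔ (fun i => (z i / t : ℝ)) ∈ A := fun z => by simp [hL]
  rw [Set.ncard_eq_toFinset_card _ hfin, ← hL]
  set d := Fintype.card ι
  have hvol : ∀ S : Finset (ι → ℤ), volume (⋃ z ∈ S, cell t z) = S.card * ENNReal.ofReal t⁻¹ ^ d := by
    intro S
    rw [measure_biUnion_finset (fun z _ w _ h => pairwise_disjoint_cell ht0 h)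
      fun z _ => measurableSet_cell t z]
    simp [volume_cell, d]
  have hvol' : ∀ S : Finset (ι → ℤ), (volume (⋃ z ∈ S, cell t z)).toReal = S.card / t ^ d := by
    intro S
    rw [hvol, ENNReal.toReal_mul, ENNReal.toReal_pow, ENNReal.toReal_ofReal (by positivity)]
    simp [div_eq_mul_inv]
  have hvtop : ∀ S : Finset (ι → ℤ), volume (⋃ z ∈ S, cell t z) ≠ ⊤ := by
    intro S
    rw [hvol]
    exact ENNReal.mul_ne_top (by simp) (ENNReal.pow_ne_top ENNReal.ofReal_ne_top)
  have htd : 0 < t ^ d := by positivity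
  -- A cell meeting `A` whose corner is not in `A` is connected and meets both sides, hence meets
  -- `K`.
  have h1 : (volume A).toReal ≤ (L ∪ B).card / t ^ d := by
    rw [← hvol']
    refine ENNReal.toReal_mono (hvtop _) (measure_mono fun x hx => ?_)
    have hxc : x ∈ cell t fun i => ⌊t * x i⌋ := (mem_cell_iff ht0).2 fun i => rfl
    refine Set.mem_biUnion (x := fun i => ⌊t * x i⌋) ?_ hxc
    rw [Finset.mem_coe, Finset.mem_union, or_iff_not_imp_left, hmemL]
    intro h
    exact hB' _ (hsep _ (isPreconnected_cell t _) ⟨x, hxc, hx⟩ ⟨_, corner_mem_cell ht0 _, h⟩)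
  -- Dually, a cell with corner in `A` that misses `K` lies inside `A`.
  have h2 : ((L \ B).card : ℝ) / t ^ d ≤ (volume A).toReal := by
    rw [← hvol']
    refine ENNReal.toReal_mono htop (measure_mono ?_)
    refine Set.iUnion₂_subset fun z hz x hx => ?_
    rw [Finset.mem_sdiff, hmemL] at hz
    by_contra h
    exact hz.2 (hB' _ (hsep _ (isPreconnected_cell t _) ⟨_, corner_mem_cell ht0 _, hz.1⟩ ⟨x, hx, h⟩))
  rw [le_div_iff₀ htd] at h1
  rw [div_le_iff₀ htd] at h2
  have h3 : ((L ∪ B).card : ℝ) ≤ L.card + B.card := by exact_mod_cast Finset.card_union_le L B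
  have h4 : (L.card : ℝ) ≤ (L \ B).card + B.card := by
    exact_mod_cast Finset.card_le_card_sdiff_add_card
  rw [abs_le]
  constructor <;> linarith

end LatticePoints

/-! ### Star bodies of homogeneous functions -/

section Homogeneous

variable {E : Type*} [NormedAddCommGroup E] [NormedSpace ℝ E] {φ : E → ℝ}

/-- The set is the cone over the compact level set with apex `0`; continuity of `φ` is not needed.
-/
theorem isCompact_sublevel_one (hpos : ∀ x, x ≠ 0 → 0 < φ x)
    (hsmul : ∀ (t : ℝ) x, φ (t • x) = |t| * φ x)
    (hK : IsCompact {x | φ x = 1}) : IsCompact {x | φ x ≤ 1} := by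
  have h0 : φ 0 = 0 := by simpa using hsmul 0 0
  have : {x | φ x ≤ 1} = {0} ∪ (fun p : ℝ × E => p.1 • p.2) '' (Set.Icc 0 1 ×ˢ {x | φ x = 1}) := by
    ext x
    constructor
    · intro hx
      by_cases h : x = 0
      · exact Or.inl h
      · have hx0 := hpos x h
        refine Or.inr ⟨(φ x, (φ x)⁻¹ • x), ⟨⟨hx0.le, hx⟩, ?_⟩, ?_⟩
        · simp [hsmul, abs_of_pos hx0, hx0.ne']
        · simp [hx0.ne']
    · rintro (rfl | ⟨⟨r, y⟩, ⟨hr, hy⟩, rfl⟩)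
      · simp [h0]
      · have hy : φ y = 1 := hy
        simp only [Set.mem_ofPred_eq, hsmul, hy, abs_of_nonneg hr.1, mul_one]
        exact hr.2
  rw [this]
  exact isCompact_singleton.union ((isCompact_Icc.prod hK).image (by fun_prop))

/-- These are the points that some `r ∈ [0, 1]` scales into the level set, and projection along the
compact `[0, 1]` is closed. -/
theorem isClosed_superlevel_one (hpos : ∀ x, x ≠ 0 → 0 < φ x)
    (hsmul : ∀ (t : ℝ) x, φ (t • x) = |t| * φ x)
    (hK : IsCompact {x | φ x = 1}) : IsClosed {x | 1 ≤ φ x} := by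
  have h0 : φ 0 = 0 := by simpa using hsmul 0 0
  have : {x | 1 ≤ φ x} =
      Prod.snd '' {p : Set.Icc (0 : ℝ) 1 × E | (p.1 : ℝ) • p.2 ∈ {x | φ x = 1}} := by
    ext x
    constructor
    · intro hx
      have hx : 1 ≤ φ x := hx
      have hx0 : 0 < φ x := by linarith
      exact ⟨(⟨(φ x)⁻¹, by positivity, inv_le_one_of_one_le₀ hx⟩, x),
        by simp [hsmul, abs_of_pos hx0, hx0.ne'], rfl⟩
    · rintro ⟨⟨⟨r, hr⟩, y⟩, hy, rfl⟩
      have hy : φ (r • y) = 1 := hy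
      rw [hsmul, abs_of_nonneg hr.1] at hy
      have : 0 ≤ φ y := by
        by_cases h : y = 0
        · rw [h, h0]
        · exact (hpos y h).le
      show 1 ≤ φ y
      nlinarith [hr.2]
  rw [this]
  exact isClosedMap_snd_of_compactSpace _ (hK.isClosed.preimage (by fun_prop))

/-- Replaces the intermediate value theorem: the closed sets `φ ≤ 1` and `1 ≤ φ` cover the
preconnected `Q`, so they meet inside it. -/
theorem inter_level_one_nonempty (hpos : ∀ x, x ≠ 0 → 0 < φ x)
    (hsmul : ∀ (t : ℝ) x, φ (t • x) = |t| * φ x) (hK : IsCompact {x | φ x = 1}) {Q : Set E}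
    (hQ : IsPreconnected Q) (h1 : (Q ∩ {x | φ x ≤ 1}).Nonempty)
    (h2 : (Q ∩ {x | φ x ≤ 1}ᶜ).Nonempty) : (Q ∩ {x | φ x = 1}).Nonempty := by
  obtain ⟨x, hxQ, hx⟩ := isPreconnected_closed_iff.1 hQ _ _
    (isCompact_sublevel_one hpos hsmul hK).isClosed (isClosed_superlevel_one hpos hsmul hK)
    (fun x _ => le_total (φ x) 1) h1
    (h2.mono fun x hx => ⟨hx.1, (not_le.1 fun h => hx.2 h : 1 < φ x).le⟩)
  exact ⟨x, hxQ, le_antisymm hx.1 hx.2⟩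

end Homogeneous

/-! ### The substitution `x + 1/x` and self-reciprocal polynomials -/

section RecipLift

variable {R S : Type*} [CommRing R] [CommRing S]

/-- The polynomial `x ^ m * f(x + 1/x)` for `f` of degree at most `m`. -/
def recipLift (m : ℕ) (f : R[X]) : R[X] :=
  ∑ k ∈ Finset.range (m + 1), C (f.coeff k) * (X ^ 2 + 1) ^ k * X ^ (m - k)

theorem toLaurent_recipLift {m : ℕ} {f : R[X]} (hf : f.natDegree ≤ m) :
    toLaurent (recipLift m f) =
      aeval (LaurentPolynomial.T 1 + LaurentPolynomial.T (-1)) f * LaurentPolynomial.T m := by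
  rw [recipLift, map_sum, aeval_eq_sum_range' (Nat.lt_succ_of_le hf), Finset.sum_mul]
  refine Finset.sum_congr rfl fun k hk => ?_
  have hk : k ≤ m := Nat.lt_succ_iff.1 (Finset.mem_range.1 hk)
  have h1 : toLaurent ((X : R[X]) ^ 2 + 1) =
      (LaurentPolynomial.T 1 + LaurentPolynomial.T (-1)) * LaurentPolynomial.T 1 := by
    rw [add_mul, ← LaurentPolynomial.T_add, ← LaurentPolynomial.T_add, map_add, toLaurent_X_pow,
      toLaurent_one]
    simp
  rw [map_mul, map_mul, map_pow, h1, toLaurent_X_pow, mul_pow, LaurentPolynomial.T_pow,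
    toLaurent_C, Algebra.smul_def, LaurentPolynomial.algebraMap_apply, mul_assoc, mul_assoc,
    mul_assoc, ← LaurentPolynomial.T_add]
  congr 3
  push_cast [hk]
  simp

theorem recipLift_map (φ : R →+* S) (m : ℕ) (f : R[X]) :
    recipLift m (f.map φ) = (recipLift m f).map φ := by
  simp [recipLift, Polynomial.map_sum]

theorem recipLift_succ (m : ℕ) (f : R[X]) :
    recipLift (m + 1) f = C (f.coeff (m + 1)) * (X ^ 2 + 1) ^ (m + 1) + X * recipLift m f := by
  rw [recipLift, Finset.sum_range_succ, add_comm, recipLift, Finset.mul_sum]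
  congr 1
  · simp
  · refine Finset.sum_congr rfl fun k hk => ?_
    have hk : k ≤ m := Nat.lt_succ_iff.1 (Finset.mem_range.1 hk)
    rw [Nat.succ_sub hk, Nat.succ_eq_add_one]
    ring

theorem coeff_zero_recipLift (m : ℕ) (f : R[X]) : (recipLift m f).coeff 0 = f.coeff m := by
  cases m with
  | zero => simp [recipLift]
  | succ m =>
    rw [recipLift_succ, coeff_add, coeff_X_mul_zero, coeff_C_mul, coeff_zero_eq_eval_zero]
    simp

/-- The constant term of the lift is the coefficient at `m`; subtracting its contribution and
cancelling `X` lowers `m`. -/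
theorem coeff_eq_of_recipLift_eq {m : ℕ} {f g : R[X]} (h : recipLift m f = recipLift m g) :
    ∀ k ≤ m, f.coeff k = g.coeff k := by
  induction m with
  | zero =>
    intro k hk
    rw [Nat.le_zero.1 hk, ← coeff_zero_recipLift, h, coeff_zero_recipLift]
  | succ m ih =>
    have h0 : f.coeff (m + 1) = g.coeff (m + 1) := by
      rw [← coeff_zero_recipLift, h, coeff_zero_recipLift]
    have h1 : recipLift m f = recipLift m g := by
      rw [recipLift_succ, recipLift_succ, h0, add_right_inj] at h
      ext n
      simpa using congrArg (fun p => p.coeff (n + 1)) h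
    intro k hk
    rcases Nat.le_succ_iff.1 hk with hk | rfl
    · exact ih h1 k hk
    · exact h0

theorem recipLift_injOn {m : ℕ} {f g : R[X]} (hf : f.natDegree ≤ m) (hg : g.natDegree ≤ m)
    (h : recipLift m f = recipLift m g) : f = g := by
  ext k
  by_cases hk : k ≤ m
  · exact coeff_eq_of_recipLift_eq h k hk
  · rw [coeff_eq_zero_of_natDegree_lt (by omega), coeff_eq_zero_of_natDegree_lt (by omega)]

theorem natDegree_X_sq_add_one_pow_le (k : ℕ) : ((X ^ 2 + 1 : R[X]) ^ k).natDegree ≤ 2 * k := by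
  refine natDegree_pow_le_of_le k (m := 2) ?_ |>.trans (by rw [mul_comm])
  compute_degree

theorem reflect_X_sq_add_one_pow (k : ℕ) :
    reflect (2 * k) ((X ^ 2 + 1 : R[X]) ^ k) = (X ^ 2 + 1) ^ k := by
  induction k with
  | zero => simp
  | succ k ih =>
    have h : (X ^ 2 + 1 : R[X]).natDegree ≤ 2 := by compute_degree
    have h2 : reflect 2 (X ^ 2 + 1 : R[X]) = X ^ 2 + 1 := by
      rw [reflect_add, reflect_monomial, revAt_le le_rfl, reflect_one]
      simp [add_comm]
    rw [pow_succ, mul_add, mul_one, reflect_mul _ _ (natDegree_X_sq_add_one_pow_le k) h, ih, h2]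

theorem natDegree_recipLift_le (m : ℕ) (f : R[X]) : (recipLift m f).natDegree ≤ 2 * m := by
  refine natDegree_sum_le_of_forall_le _ _ fun k hk => ?_
  have hk : k ≤ m := Nat.lt_succ_iff.1 (Finset.mem_range.1 hk)
  refine natDegree_mul_le.trans ?_
  have h1 := natDegree_X_pow_le (R := R) (m - k)
  have h2 := (natDegree_C_mul_le (f.coeff k) ((X ^ 2 + 1) ^ k)).trans
    (natDegree_X_sq_add_one_pow_le k)
  omega

theorem reflect_recipLift (m : ℕ) (f : R[X]) :
    reflect (2 * m) (recipLift m f) = recipLift m f := by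
  induction m with
  | zero => simp [recipLift]
  | succ m ih =>
    have h : reflect 2 (X : R[X]) = X := by
      have := reflect_monomial (R := R) 2 1
      rwa [pow_one, revAt_le (by norm_num), pow_one] at this
    have h2 : reflect (2 * (m + 1)) (X * recipLift m f) = X * recipLift m f := by
      rw [show 2 * (m + 1) = 2 + 2 * m by ring, reflect_mul _ _
        (natDegree_X_le.trans one_le_two) (natDegree_recipLift_le m f), ih, h]
    rw [recipLift_succ, reflect_add, reflect_C_mul, reflect_X_sq_add_one_pow, h2]

/-- Subtracting a multiple of `(X ^ 2 + 1) ^ m` kills the constant term, hence by symmetry the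
coefficient at `2 * m`; dividing by `X` leaves a symmetric polynomial for `m - 1`. -/
theorem exists_eq_recipLift {m : ℕ} {p : R[X]} (hp : p.natDegree ≤ 2 * m)
    (hr : reflect (2 * m) p = p) : ∃ f : R[X], f.natDegree ≤ m ∧ recipLift m f = p := by
  induction m generalizing p with
  | zero => exact ⟨p, by simpa using hp, by
      rw [recipLift, eq_C_of_natDegree_le_zero (p := p) (by simpa using hp)]; simp⟩
  | succ m ih =>
    set c := p.coeff 0 with hc
    set q := p - C c * (X ^ 2 + 1) ^ (m + 1) with hq
    have hq0 : q.coeff 0 = 0 := by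
      rw [hq, coeff_sub, coeff_C_mul, coeff_zero_eq_eval_zero ((X ^ 2 + 1 : R[X]) ^ (m + 1))]
      simp [hc]
    have hqr : reflect (2 * (m + 1)) q = q := by
      rw [hq, reflect_sub, hr, reflect_C_mul, reflect_X_sq_add_one_pow]
    have hqd : q.natDegree ≤ 2 * (m + 1) := (natDegree_sub_le_of_le hp
      ((natDegree_C_mul_le _ _).trans (natDegree_X_sq_add_one_pow_le _))).trans (max_self _).le
    have hsymm : ∀ i ≤ 2 * (m + 1), q.coeff i = q.coeff (2 * (m + 1) - i) := by
      intro i hi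
      conv_lhs => rw [← hqr]
      rw [coeff_reflect, revAt_le hi]
    have hdeg : q.divX.natDegree ≤ 2 * m := by
      rw [natDegree_le_iff_coeff_eq_zero]
      intro i hi
      rw [coeff_divX]
      rcases eq_or_ne i (2 * m + 1) with rfl | hne
      · rw [hsymm _ (by omega)]
        simpa [mul_add] using hq0
      · exact coeff_eq_zero_of_natDegree_lt (by omega)
    have hrefl : reflect (2 * m) q.divX = q.divX := by
      ext i
      rw [coeff_reflect]
      by_cases hi : i ≤ 2 * m
      · rw [revAt_le hi, coeff_divX, coeff_divX, hsymm (i + 1) (by omega)]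
        congr 1
        omega
      · rw [revAt_eq_self_of_lt (by omega)]
    obtain ⟨g, hg, hgq⟩ := ih hdeg hrefl
    refine ⟨g + C c * X ^ (m + 1), ?_, ?_⟩
    · exact natDegree_add_le_of_le (hg.trans (Nat.le_succ m)) (natDegree_C_mul_X_pow_le _ _)
        |>.trans (by simp)
    · have h1 : recipLift m (g + C c * X ^ (m + 1)) = recipLift m g := by
        refine Finset.sum_congr rfl fun k hk => ?_
        have hk := Finset.mem_range.1 hk
        simp [coeff_X_pow, hk.ne]
      have h2 : (g + C c * X ^ (m + 1)).coeff (m + 1) = c := by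
        simp [coeff_eq_zero_of_natDegree_lt (Nat.lt_succ_of_le hg)]
      have h3 := divX_mul_X_add q
      rw [hq0, map_zero, add_zero] at h3
      rw [recipLift_succ, h1, h2, hgq, mul_comm X, h3, hq]
      ring

end RecipLift

/-! ### Multiplicativity and positivity of `rho` -/

theorem rho_eq_of_toLaurent {f p : ℂ[X]} {n : ℕ}
    (h : p.toLaurent =
      aeval (LaurentPolynomial.T 1 + LaurentPolynomial.T (-1)) f * LaurentPolynomial.T n) :
    rho f = p.mahlerMeasure :=
  laurentMahlerMeasure_eq h

theorem rho_eq_recipLift {f : ℂ[X]} {m : ℕ} (hf : f.natDegree ≤ m) :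
    rho f = (recipLift m f).mahlerMeasure :=
  rho_eq_of_toLaurent (toLaurent_recipLift hf)

theorem rho_mul (f g : ℂ[X]) : rho (f * g) = rho f * rho g := by
  have h : (recipLift f.natDegree f * recipLift g.natDegree g).toLaurent =
      aeval (LaurentPolynomial.T 1 + LaurentPolynomial.T (-1)) (f * g) *
        LaurentPolynomial.T (f.natDegree + g.natDegree : ℕ) := by
    rw [map_mul, toLaurent_recipLift le_rfl, toLaurent_recipLift le_rfl, map_mul, Nat.cast_add,
      LaurentPolynomial.T_add]
    ring
  rw [rho_eq_of_toLaurent h, mahlerMeasure_mul, ← rho_eq_recipLift le_rfl,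
    ← rho_eq_recipLift le_rfl]

theorem rho_C (c : ℂ) : rho (C c) = ‖c‖ := by
  have h : (C c : ℂ[X]).toLaurent = aeval (LaurentPolynomial.T 1 + LaurentPolynomial.T (-1))
      (C c) * LaurentPolynomial.T (0 : ℕ) := by
    simp [aeval_C]
  rw [rho_eq_of_toLaurent h, mahlerMeasure_const]

theorem rho_one : rho 1 = 1 := by simpa using rho_C 1

theorem rho_C_mul (c : ℂ) (f : ℂ[X]) : rho (C c * f) = ‖c‖ * rho f := by
  rw [rho_mul, rho_C]

theorem recipLift_eq_zero_iff {R : Type*} [CommRing R] {m : ℕ} {f : R[X]}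
    (hf : f.natDegree ≤ m) : recipLift m f = 0 ↔ f = 0 := by
  have h0 : recipLift m (0 : R[X]) = 0 := by simp [recipLift]
  exact ⟨fun h => recipLift_injOn hf (by simp) (h.trans h0.symm), fun h => h ▸ h0⟩

theorem rho_pos {f : ℂ[X]} (hf : f ≠ 0) : 0 < rho f := by
  rw [rho_eq_recipLift le_rfl]
  exact mahlerMeasure_pos_of_ne_zero ((recipLift_eq_zero_iff le_rfl).not.2 hf)

theorem mahlerMeasure_C_mul_X_add_C' (a b : ℂ) : (C a * X + C b).mahlerMeasure = max ‖a‖ ‖b‖ := by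
  by_cases ha : a = 0
  · simp [ha]
  · exact mahlerMeasure_C_mul_X_add_C ha b

/-- The linear polynomials that lift to `(u z - w) (z - u w⁻¹)` with `|w| = 1`, `|u| ≤ 1`. -/
theorem rho_linear {u : ℝ} (hu : |u| ≤ 1) {w w' : ℂ} (hw : ‖w‖ = 1) (hww : w * w' = 1) :
    rho (C (u : ℂ) * X - C (w + u ^ 2 * w')) = 1 := by
  have hw' : ‖w'‖ = 1 := by
    have := congrArg norm hww
    rw [norm_mul, hw] at this
    simpa using this
  have h : ((C (u : ℂ) * X + C (-w)) * (C 1 * X + C (-(u * w'))) : ℂ[X]).toLaurent =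
      aeval (LaurentPolynomial.T 1 + LaurentPolynomial.T (-1))
        (C (u : ℂ) * X - C (w + u ^ 2 * w')) * LaurentPolynomial.T (1 : ℕ) := by
    have e : ((C (u : ℂ) * X + C (-w)) * (C 1 * X + C (-(u * w'))) : ℂ[X]) =
        C (u : ℂ) * (X ^ 2 + 1) - C (w + u ^ 2 * w') * X := by
      have : (C (u : ℂ) : ℂ[X]) = C (u : ℂ) * (C w * C w') := by rw [← C_mul, hww]; simp
      simp only [map_neg, map_mul, map_add, map_pow, map_one]
      linear_combination (-1 : ℂ[X]) * this
    rw [e]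
    simp only [map_sub, map_mul, aeval_C, aeval_X, map_add (toLaurent), toLaurent_X_pow,
      toLaurent_one, toLaurent_C, toLaurent_X, LaurentPolynomial.algebraMap_apply, sub_mul,
      add_mul, mul_assoc, mul_add, ← LaurentPolynomial.T_add]
    simp
  rw [rho_eq_of_toLaurent h, mahlerMeasure_mul, mahlerMeasure_C_mul_X_add_C',
    mahlerMeasure_C_mul_X_add_C']
  simp [hw, hw', hu]

/-! ### Coefficient vectors -/

section CoeffPoly

variable {R S : Type*} [CommRing R] [CommRing S] {N : ℕ}

/-- The polynomial with coefficient vector `a`, leading term first, over any ring. -/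
def coeffPoly (a : Fin (N + 1) → R) : R[X] := ∑ i : Fin (N + 1), C (a i) * X ^ (N - (i : ℕ))

/-- The coefficient vector of length `N + 1` of a polynomial, leading term first. -/
def coeffVec (N : ℕ) (p : R[X]) : Fin (N + 1) → R := fun i => p.coeff (N - (i : ℕ))

theorem coeffPoly_map (φ : R →+* S) (a : Fin (N + 1) → R) :
    (coeffPoly a).map φ = coeffPoly fun i => φ (a i) := by
  simp [coeffPoly, Polynomial.map_sum]

theorem coeffVec_coeffPoly (a : Fin (N + 1) → R) : coeffVec N (coeffPoly a) = a := by
  funext i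
  simp only [coeffVec, coeffPoly, finsetSum_coeff, coeff_C_mul, coeff_X_pow, mul_ite, mul_one,
    mul_zero]
  rw [Finset.sum_eq_single i]
  · simp
  · intro j _ hj
    have : (j : ℕ) ≠ i := fun h => hj (Fin.ext h)
    rw [if_neg (by omega)]
  · simp

theorem coeffPoly_injective : Function.Injective (coeffPoly : (Fin (N + 1) → R) → R[X]) :=
  Function.LeftInverse.injective coeffVec_coeffPoly

theorem natDegree_coeffPoly_le (a : Fin (N + 1) → R) : (coeffPoly a).natDegree ≤ N :=
  natDegree_sum_le_of_forall_le _ _ fun _ _ => (natDegree_C_mul_X_pow_le _ _).trans (Nat.sub_le _ _)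

theorem coeffPoly_coeffVec {p : R[X]} (hp : p.natDegree ≤ N) : coeffPoly (coeffVec N p) = p := by
  conv_rhs => rw [p.as_sum_range_C_mul_X_pow' (Nat.lt_succ_of_le hp), ← Finset.sum_range_reflect,
    Finset.sum_range]
  refine Finset.sum_congr rfl fun i _ => ?_
  simp [coeffVec]

theorem coeffPoly_smul (c : R) (a : Fin (N + 1) → R) : coeffPoly (c • a) = C c * coeffPoly a := by
  simp [coeffPoly, Finset.mul_sum, mul_assoc]

/-- The coefficient vector of the product of two polynomials. -/
def mulCoeffs {m n : ℕ} (a : Fin (m + 1) → R) (b : Fin (n + 1) → R) : Fin (m + n + 1) → R :=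
  fun k => ∑ i : Fin (m + 1), ∑ j : Fin (n + 1), if (i : ℕ) + j = k then a i * b j else 0

theorem coeffPoly_mulCoeffs {m n : ℕ} (a : Fin (m + 1) → R) (b : Fin (n + 1) → R) :
    coeffPoly (mulCoeffs a b) = coeffPoly a * coeffPoly b := by
  rw [coeffPoly, coeffPoly, coeffPoly, Finset.sum_mul_sum]
  simp only [mulCoeffs, map_sum, Finset.sum_mul]
  rw [Finset.sum_comm]
  refine Finset.sum_congr rfl fun i _ => ?_
  rw [Finset.sum_comm]
  refine Finset.sum_congr rfl fun j _ => ?_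
  rw [Finset.sum_eq_single (⟨i + j, by omega⟩ : Fin (m + n + 1))]
  · have : m + n - ((i : ℕ) + j) = (m - i) + (n - j) := by omega
    simp only [if_true, this, pow_add, C_mul]
    ring
  · intro k _ hk
    rw [if_neg fun h => hk (Fin.ext h.symm)]
    simp
  · simp

end CoeffPoly

/-! ### The level set `rho = 1` and its factorisation -/

/-- The reciprocal Mahler measure of a real polynomial. -/
def realRho (p : ℝ[X]) : ℝ := rho (p.map Complex.ofRealHom)

theorem realRho_mul (p q : ℝ[X]) : realRho (p * q) = realRho p * realRho q := by
  rw [realRho, Polynomial.map_mul, rho_mul, realRho, realRho]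

theorem realRho_C_mul (c : ℝ) (p : ℝ[X]) : realRho (C c * p) = |c| * realRho p := by
  rw [realRho, Polynomial.map_mul, map_C, rho_C_mul, realRho]
  simp

theorem realRho_one : realRho 1 = 1 := by simp [realRho, rho_one]

theorem realRho_pos {p : ℝ[X]} (hp : p ≠ 0) : 0 < realRho p :=
  rho_pos ((Polynomial.map_ne_zero_iff Complex.ofRealHom.injective).2 hp)

theorem realRho_zero : realRho 0 = 0 := by simpa using realRho_C_mul 0 0

theorem ne_zero_of_realRho_eq_one {p : ℝ[X]} (hp : realRho p = 1) : p ≠ 0 := by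
  rintro rfl
  simp [realRho_zero] at hp

/-- The coefficient vectors of real polynomials of reciprocal Mahler measure one. -/
def sphere (N : ℕ) : Set (Fin (N + 1) → ℝ) := {a | realRho (coeffPoly a) = 1}

theorem mem_sphere {N : ℕ} {a : Fin (N + 1) → ℝ} : a ∈ sphere N ↔ realRho (coeffPoly a) = 1 :=
  Iff.rfl

/-- Each factor is rescaled to measure one; the two scalars cancel because `realRho p * realRho q =
1`. -/
theorem mem_image_mulCoeffs {m n : ℕ} {c : Fin (m + n + 1) → ℝ} (hc : c ∈ sphere (m + n))
    {p q : ℝ[X]} (hp : p.natDegree ≤ m) (hq : q.natDegree ≤ n) (h : coeffPoly c = p * q) :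
    c ∈ (fun x : (Fin (m + 1) → ℝ) × (Fin (n + 1) → ℝ) => mulCoeffs x.1 x.2) ''
      (sphere m ×ˢ sphere n) := by
  have hpq : realRho p * realRho q = 1 := by rw [← realRho_mul, ← h]; exact hc
  have hne : p * q ≠ 0 := h ▸ ne_zero_of_realRho_eq_one hc
  have hp0 := realRho_pos (left_ne_zero_of_mul hne)
  have hq0 := realRho_pos (right_ne_zero_of_mul hne)
  refine ⟨((realRho p)⁻¹ • coeffVec m p, (realRho q)⁻¹ • coeffVec n q), ⟨?_, ?_⟩, ?_⟩
  · rw [mem_sphere, coeffPoly_smul, coeffPoly_coeffVec hp, realRho_C_mul, abs_inv, abs_of_pos hp0,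
      inv_mul_cancel₀ hp0.ne']
  · rw [mem_sphere, coeffPoly_smul, coeffPoly_coeffVec hq, realRho_C_mul, abs_inv, abs_of_pos hq0,
      inv_mul_cancel₀ hq0.ne']
  · refine coeffPoly_injective ?_
    simp only [coeffPoly_mulCoeffs, coeffPoly_smul, coeffPoly_coeffVec hp, coeffPoly_coeffVec hq, h]
    have : (C (realRho p)⁻¹ * C (realRho q)⁻¹ : ℝ[X]) = 1 := by
      rw [← C_mul, ← mul_inv, hpq, inv_one, C_1]
    linear_combination (p * q) * this

theorem mulCoeffs_mem_sphere {m n : ℕ} {a : Fin (m + 1) → ℝ} {b : Fin (n + 1) → ℝ}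
    (ha : a ∈ sphere m) (hb : b ∈ sphere n) : mulCoeffs a b ∈ sphere (m + n) := by
  rw [mem_sphere] at *
  rw [coeffPoly_mulCoeffs, realRho_mul, ha, hb, one_mul]

theorem contDiff_mulCoeffs (m n : ℕ) : ContDiff ℝ 1
    fun x : (Fin (m + 1) → ℝ) × (Fin (n + 1) → ℝ) => mulCoeffs x.1 x.2 := by
  refine contDiff_pi.2 fun k => ?_
  unfold mulCoeffs
  refine ContDiff.sum fun i _ => ContDiff.sum fun j _ => ?_
  split_ifs <;> fun_prop

/-- Every real polynomial of degree at least two has a real factor of degree two. -/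
theorem sphere_add_two (J : ℕ) : sphere (J + 2) =
    (fun x : (Fin (J + 1) → ℝ) × (Fin (2 + 1) → ℝ) => mulCoeffs x.1 x.2) ''
      (sphere J ×ˢ sphere 2) := by
  refine Set.Subset.antisymm (fun c hc => ?_) ?_
  · by_cases h : (coeffPoly c).natDegree < 2
    · exact mem_image_mulCoeffs hc (p := 1) (by simp) (by omega) (one_mul _).symm
    · obtain ⟨n, hn⟩ := Nat.exists_eq_add_of_le' (not_lt.1 h)
      have hl : (coeffPoly c).leadingCoeff ≠ 0 :=
        leadingCoeff_ne_zero.2 (ne_zero_of_realRho_eq_one hc)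
      have hm : IsMonicOfDegree (C (coeffPoly c).leadingCoeff⁻¹ * coeffPoly c) (n + 2) := by
        refine ⟨?_, ?_⟩
        · rw [natDegree_C_mul (inv_ne_zero hl), hn]
        · rw [Monic, leadingCoeff_mul, leadingCoeff_C, inv_mul_cancel₀ hl]
      obtain ⟨f, g, hf, hg, hfg⟩ := hm.eq_isMonicOfDegree_two_mul_isMonicOfDegree
      have hnJ := natDegree_coeffPoly_le c
      refine mem_image_mulCoeffs hc (p := C (coeffPoly c).leadingCoeff * g) (q := f)
        ((natDegree_C_mul_le _ _).trans ?_) hf.natDegree_eq.le ?_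
      · rw [hg.natDegree_eq]; omega
      · rw [mul_assoc, mul_comm g, ← hfg, ← mul_assoc, ← C_mul, mul_inv_cancel₀ hl, C_1, one_mul]
  · rintro _ ⟨⟨a, b⟩, ⟨ha, hb⟩, rfl⟩
    exact mulCoeffs_mem_sphere ha hb

/-! ### Parametrisation in degrees one and two -/

/-- The Joukowski map is onto, in homogeneous form. -/
theorem exists_joukowski (z : ℂ) : ∃ (u : ℝ) (w : ℂ), 0 < u ∧ u ≤ 1 ∧ ‖w‖ = 1 ∧
    u * z = w + u ^ 2 * (starRingEnd ℂ) w := by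
  -- `α` and `β` are the roots of `T ^ 2 - z * T + 1`, `α` being one outside the open unit disc;
  -- then `u = 1 / ‖α‖` and `w = α / ‖α‖`.
  have key : ∀ α β : ℂ, α * β = 1 → α + β = z → 1 ≤ ‖α‖ → ∃ (u : ℝ) (w : ℂ), 0 < u ∧ u ≤ 1 ∧
      ‖w‖ = 1 ∧ u * z = w + u ^ 2 * (starRingEnd ℂ) w := by
    intro α β h1 h2 h3
    have h0 : 0 < ‖α‖ := by linarith
    refine ⟨‖α‖⁻¹, (‖α‖⁻¹ : ℝ) * α, by positivity, inv_le_one_of_one_le₀ h3, ?_, ?_⟩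
    · rw [norm_mul, Complex.norm_real, norm_inv, norm_norm, inv_mul_cancel₀ h0.ne']
    · have h4 : α * (starRingEnd ℂ) α = (‖α‖ : ℂ) ^ 2 := by
        rw [Complex.mul_conj, Complex.normSq_eq_norm_sq]; push_cast; rfl
      have h5 : (‖α‖ : ℂ) ≠ 0 := by exact_mod_cast h0.ne'
      have h6 : (starRingEnd ℂ) α = (‖α‖ : ℂ) ^ 2 * β := by
        rw [← h4]; linear_combination (-(starRingEnd ℂ) α) * h1
      rw [map_mul, Complex.conj_ofReal, h6, ← h2]
      push_cast
      field_simp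
  obtain ⟨s, hs⟩ := IsAlgClosed.exists_pow_nat_eq (z ^ 2 - 4) two_pos
  have h1 : (z + s) / 2 * ((z - s) / 2) = 1 := by linear_combination (-1 / 4 : ℂ) * hs
  rcases le_total 1 ‖(z + s) / 2‖ with h | h
  · exact key _ _ h1 (by ring) h
  · refine key ((z - s) / 2) ((z + s) / 2) (by rw [mul_comm, h1]) (by ring) ?_
    have := congrArg norm h1
    rw [norm_mul, norm_one] at this
    nlinarith [norm_nonneg ((z - s) / 2)]

theorem norm_unit_circle {c : ℝ} (hc : |c| ≤ 1) :
    ∃ w : ℂ, ‖w‖ = 1 ∧ w * (starRingEnd ℂ) w = 1 ∧ w.re = c := by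
  have h : c ^ 2 ≤ 1 := by rw [← sq_abs]; exact pow_le_one₀ (abs_nonneg c) hc
  have h2 : Complex.normSq ⟨c, √(1 - c ^ 2)⟩ = 1 := by
    rw [Complex.normSq_mk, Real.mul_self_sqrt (by linarith)]; ring
  refine ⟨⟨c, √(1 - c ^ 2)⟩, ?_, ?_, rfl⟩
  · rw [Complex.norm_def, h2, Real.sqrt_one]
  · rw [Complex.mul_conj, h2, Complex.ofReal_one]

theorem coeffPoly_one {R : Type*} [CommRing R] (a b : R) :
    coeffPoly (N := 1) ![a, b] = C a * X + C b := by
  simp [coeffPoly, Fin.sum_univ_succ]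

theorem coeffPoly_two {R : Type*} [CommRing R] (a b c : R) :
    coeffPoly (N := 2) ![a, b, c] = C a * X ^ 2 + C b * X + C c := by
  simp [coeffPoly, Fin.sum_univ_succ, add_assoc]

/-- The case of a real root `u + 1/u` outside `(-2, 2)`; `u = 0` gives the constant `-1`, the root
at infinity. -/
theorem realRho_outer {u : ℝ} (hu : |u| ≤ 1) :
    realRho (coeffPoly (N := 1) ![u, -(1 + u ^ 2)]) = 1 := by
  have := rho_linear hu (w := 1) (w' := 1) (by simp) (by simp)
  rw [realRho, coeffPoly_one]
  refine Eq.trans ?_ this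
  simp [sub_eq_add_neg]

/-- The case of a real root `2 * c` in `[-2, 2]`. -/
theorem realRho_inner {c : ℝ} (hc : |c| ≤ 1) :
    realRho (coeffPoly (N := 1) ![1, -(2 * c)]) = 1 := by
  obtain ⟨w, hw, hww, hre⟩ := norm_unit_circle hc
  have := rho_linear (u := 1) (by simp) hw hww
  rw [realRho, coeffPoly_one]
  refine Eq.trans ?_ this
  have h : w + (starRingEnd ℂ) w = 2 * c := by rw [Complex.add_conj, hre]; push_cast; ring
  simp [sub_eq_add_neg, h]

/-- The product of the linear polynomials of `rho_linear` for `w` and its conjugate, where `w.re =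
c`. -/
theorem realRho_quadratic {u c : ℝ} (hu : |u| ≤ 1) (hc : |c| ≤ 1) :
    realRho (coeffPoly (N := 2)
      ![u ^ 2, -(2 * u * (1 + u ^ 2) * c), (1 - u ^ 2) ^ 2 + 4 * u ^ 2 * c ^ 2]) = 1 := by
  obtain ⟨w, hw, hww, hre⟩ := norm_unit_circle hc
  have h1 := rho_linear hu hw hww
  have h2 := rho_linear hu (w := (starRingEnd ℂ) w) (w' := w) (by rwa [RCLike.norm_conj])
    (by rwa [mul_comm])
  have h : w + (starRingEnd ℂ) w = 2 * c := by rw [Complex.add_conj, hre]; push_cast; ring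
  have h12 := rho_mul (C (u : ℂ) * X - C (w + u ^ 2 * (starRingEnd ℂ) w))
    (C (u : ℂ) * X - C ((starRingEnd ℂ) w + u ^ 2 * w))
  rw [h1, h2, one_mul] at h12
  rw [realRho, coeffPoly_two]
  refine Eq.trans ?_ h12
  congr 1
  have hC : (C w + C ((starRingEnd ℂ) w) : ℂ[X]) = 2 * C (c : ℂ) := by
    rw [← C_add, h, C_mul]; rfl
  have hC' : (C w * C ((starRingEnd ℂ) w) : ℂ[X]) = 1 := by rw [← C_mul, hww, C_1]
  have h2C : (C (2 : ℂ) : ℂ[X]) = 2 := rfl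
  have h4C : (C (4 : ℂ) : ℂ[X]) = 4 := rfl
  simp only [Polynomial.map_add, Polynomial.map_mul, Polynomial.map_pow, map_C, map_X,
    Polynomial.map_neg, Polynomial.map_sub, Polynomial.map_one, Complex.ofRealHom_eq_coe,
    Complex.ofReal_ofNat, C_mul, C_add, C_sub, C_neg, C_pow, C_1, h2C, h4C]
  linear_combination (C (u : ℂ) * X * (1 + C (u : ℂ) ^ 2) -
    C (u : ℂ) ^ 2 * (C w + C ((starRingEnd ℂ) w) + 2 * C (c : ℂ))) * hC -
    (1 - C (u : ℂ) ^ 2) ^ 2 * hC'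

/-- The numbers `±1`. -/
def signs : Set ℝ := {1, -1}

theorem mem_signs_iff {s : ℝ} : s ∈ signs ↔ |s| = 1 := by
  rw [abs_eq zero_le_one]; rfl

theorem hasCover_signs : HasCover 0 signs := HasCover.of_finite (Set.toFinite {1, -1})

theorem smul_mem_sphere {N : ℕ} {a : Fin (N + 1) → ℝ} (ha : realRho (coeffPoly a) = 1) {s : ℝ}
    (hs : s ∈ signs) : s • a ∈ sphere N := by
  rw [mem_sphere, coeffPoly_smul, realRho_C_mul, mem_signs_iff.1 hs, ha, one_mul]

theorem mem_signs_of_smul {N : ℕ} {a : Fin (N + 1) → ℝ} (ha : realRho (coeffPoly a) = 1) {s : ℝ}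
    (h : s • a ∈ sphere N) : s ∈ signs := by
  rwa [mem_sphere, coeffPoly_smul, realRho_C_mul, ha, mul_one, ← mem_signs_iff] at h

theorem hasCover_sphere_zero : HasCover 0 (sphere 0) := by
  have : sphere 0 = (fun s : ℝ => fun _ : Fin 1 => s) '' signs := by
    ext a
    have h : ∀ a : Fin 1 → ℝ, a ∈ sphere 0 ↔ |a 0| = 1 := by
      intro a
      have e : coeffPoly (N := 0) a = C (a 0) * 1 := by simp [coeffPoly]
      rw [mem_sphere, e, realRho_C_mul, realRho_one, mul_one]
    rw [h]
    constructor
    · intro ha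
      refine ⟨a 0, mem_signs_iff.2 ha, ?_⟩
      funext i
      rw [Subsingleton.elim i 0]
    · rintro ⟨s, hs, rfl⟩
      exact mem_signs_iff.1 hs
  rw [this]
  exact hasCover_signs.image (by fun_prop)

theorem sphere_one : sphere 1 =
    (fun x : ℝ × ℝ => x.1 • ![x.2, -(1 + x.2 ^ 2)]) '' (signs ×ˢ Set.Icc (-1) 1) ∪
    (fun x : ℝ × ℝ => x.1 • ![1, -(2 * x.2)]) '' (signs ×ˢ Set.Icc (-1) 1) := by
  refine Set.Subset.antisymm (fun a ha => ?_) ?_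
  · have hvec : a = ![a 0, a 1] := by
      funext i; fin_cases i <;> rfl
    have outer : ∀ s u : ℝ, |u| ≤ 1 → a = s • ![u, -(1 + u ^ 2)] →
        a ∈ (fun x : ℝ × ℝ => x.1 • ![x.2, -(1 + x.2 ^ 2)]) '' (signs ×ˢ Set.Icc (-1) 1) :=
      fun s u hu h => ⟨(s, u), ⟨mem_signs_of_smul (realRho_outer hu) (h ▸ ha), abs_le.1 hu⟩, h.symm⟩
    by_cases h0 : a 0 = 0
    · refine Or.inl (outer (-a 1) 0 (by simp) ?_)
      rw [hvec, h0]
      simp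
    · obtain ⟨u, w, hu0, hu1, hw, h⟩ := exists_joukowski ((-(a 1) / a 0 : ℝ) : ℂ)
      have hsq : w.re ^ 2 + w.im ^ 2 = 1 := by
        have := Complex.sq_norm w
        rw [hw, Complex.normSq_apply] at this
        linarith
      have hre := congrArg Complex.re h
      have him := congrArg Complex.im h
      rw [← Complex.ofReal_pow, ← Complex.ofReal_mul, Complex.add_im, Complex.im_ofReal_mul,
        Complex.ofReal_im, Complex.conj_im] at him
      rw [← Complex.ofReal_pow, ← Complex.ofReal_mul, Complex.add_re, Complex.re_ofReal_mul,
        Complex.ofReal_re, Complex.conj_re] at hre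
      -- The root is real, so either `u = 1` (root in `[-2, 2]`) or `w = ±1` (root outside `(-2,
      -- 2)`).
      have him' : (1 - u ^ 2) * w.im = 0 := by linarith
      rcases mul_eq_zero.1 him' with h1 | h1
      · have hu : u = 1 := by nlinarith
        subst hu
        have hc : |w.re| ≤ 1 := hw ▸ Complex.abs_re_le_norm w
        have e : a = a 0 • ![1, -(2 * w.re)] := by
          conv_lhs => rw [hvec]
          have : a 1 = a 0 * -(2 * w.re) := by field_simp at hre; linarith
          simp [this]
        exact Or.inr ⟨(a 0, w.re), ⟨mem_signs_of_smul (realRho_inner hc) (e ▸ ha), abs_le.1 hc⟩,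
          e.symm⟩
      · rw [h1] at hsq
        have hw2 : w.re ^ 2 = 1 := by linarith
        have hw0 : w.re ≠ 0 := by rintro h; simp [h] at hw2
        -- The sign `w.re = ±1` is absorbed into the parameter, which ranges over `[-1, 1]`.
        refine Or.inl (outer (a 0 / (u * w.re)) (u * w.re) ?_ ?_)
        · rw [abs_mul, abs_of_pos hu0]
          exact mul_le_one₀ hu1 (abs_nonneg _) (hw ▸ Complex.abs_re_le_norm w)
        · conv_lhs => rw [hvec]
          have : a 1 = a 0 / (u * w.re) * -(1 + (u * w.re) ^ 2) := by
            rw [mul_pow, hw2]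
            field_simp at hre ⊢
            linear_combination (-w.re) * hre - (u ^ 2 + 1) * a 0 * hw2
          simp only [Matrix.smul_cons, smul_eq_mul, Matrix.smul_empty, ← this]
          congr 1
          field_simp
  · rintro _ (⟨⟨s, u⟩, ⟨hs, hu⟩, rfl⟩ | ⟨⟨s, u⟩, ⟨hs, hu⟩, rfl⟩)
    · exact smul_mem_sphere (realRho_outer (abs_le.2 hu)) hs
    · exact smul_mem_sphere (realRho_inner (abs_le.2 hu)) hs

theorem hasCover_sphere_one : HasCover 1 (sphere 1) := by
  have h := hasCover_signs.prod hasCover_Icc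
  rw [zero_add] at h
  rw [sphere_one]
  refine (h.image ?_).union (h.image ?_) <;>
  · refine contDiff_pi.2 fun i => ?_
    fin_cases i <;> simp <;> fun_prop

/-- Either the polynomial splits into real factors of degree at most one, or its roots are a nonreal
conjugate pair, to which the Joukowski map applies. -/
theorem sphere_two : sphere 2 =
    (fun x : (Fin (1 + 1) → ℝ) × (Fin (1 + 1) → ℝ) => mulCoeffs x.1 x.2) ''
      (sphere 1 ×ˢ sphere 1) ∪
    (fun x : ℝ × ℝ × ℝ => x.1 • ![x.2.1 ^ 2, -(2 * x.2.1 * (1 + x.2.1 ^ 2) * x.2.2),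
      (1 - x.2.1 ^ 2) ^ 2 + 4 * x.2.1 ^ 2 * x.2.2 ^ 2]) ''
      (signs ×ˢ Set.Icc (-1) 1 ×ˢ Set.Icc (-1) 1) := by
  refine Set.Subset.antisymm (fun a ha => ?_) ?_
  · have hvec : a = ![a 0, a 1, a 2] := by
      funext i; fin_cases i <;> rfl
    have hpoly : coeffPoly a = C (a 0) * X ^ 2 + C (a 1) * X + C (a 2) := by
      rw [← coeffPoly_two, ← hvec]
    by_cases h0 : a 0 = 0
    · refine Or.inl (mem_image_mulCoeffs (m := 1) (n := 1) ha (p := 1) (by simp) ?_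
        (one_mul _).symm)
      rw [hpoly, h0, C_0, zero_mul, zero_add]
      exact natDegree_linear_le
    have h0' : (a 0 : ℂ) ≠ 0 := by exact_mod_cast h0
    obtain ⟨s, hs⟩ := IsAlgClosed.exists_eq_mul_self (discrim (a 0 : ℂ) (a 1) (a 2))
    obtain ⟨z, hz⟩ := exists_quadratic_eq_zero h0' ⟨s, hs⟩
    have hre := congrArg Complex.re hz
    have him := congrArg Complex.im hz
    simp only [Complex.add_re, Complex.add_im,
      Complex.mul_re, Complex.mul_im, Complex.ofReal_re, Complex.ofReal_im, Complex.zero_re,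
      Complex.zero_im, add_zero] at hre him
    by_cases hzi : z.im = 0
    · rw [hzi] at hre
      have : coeffPoly a = (X - C z.re) * (C (a 0) * X + C (a 0 * z.re + a 1)) := by
        have e : a 2 = -(a 0 * (z.re * z.re) + a 1 * z.re) := by linarith
        rw [hpoly, e]
        simp only [C_add, C_mul, C_neg]
        ring
      exact Or.inl (mem_image_mulCoeffs (m := 1) (n := 1) ha (natDegree_X_sub_C_le _)
        natDegree_linear_le this)
    · have h1 : a 1 = -(2 * a 0 * z.re) := by
        have : z.im * (a 1 + 2 * a 0 * z.re) = 0 := by linarith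
        rcases mul_eq_zero.1 this with h | h
        · exact absurd h hzi
        · linarith
      have h2 : a 2 = a 0 * (z.re ^ 2 + z.im ^ 2) := by
        rw [h1] at hre; linarith
      obtain ⟨u, w, hu0, hu1, hw, h⟩ := exists_joukowski z
      have hsq : w.re ^ 2 + w.im ^ 2 = 1 := by
        have := Complex.sq_norm w
        rw [hw, Complex.normSq_apply] at this
        linarith
      have hre := congrArg Complex.re h
      have him := congrArg Complex.im h
      rw [← Complex.ofReal_pow, Complex.add_im, Complex.im_ofReal_mul, Complex.im_ofReal_mul,
        Complex.conj_im] at him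
      rw [← Complex.ofReal_pow, Complex.add_re, Complex.re_ofReal_mul, Complex.re_ofReal_mul,
        Complex.conj_re] at hre
      have hu : |u| ≤ 1 := by rwa [abs_of_pos hu0]
      have hc : |w.re| ≤ 1 := hw ▸ Complex.abs_re_le_norm w
      have e : a = (a 0 / u ^ 2) • ![u ^ 2, -(2 * u * (1 + u ^ 2) * w.re),
          (1 - u ^ 2) ^ 2 + 4 * u ^ 2 * w.re ^ 2] := by
        have e1 : a 1 = a 0 / u ^ 2 * -(2 * u * (1 + u ^ 2) * w.re) := by
          rw [h1]; field_simp; linear_combination (-1 : ℝ) * hre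
        -- The square of the norm of `u * z = w + u ^ 2 * conj w`, expanded using `‖w‖ = 1`.
        have e2 : a 2 = a 0 / u ^ 2 * ((1 - u ^ 2) ^ 2 + 4 * u ^ 2 * w.re ^ 2) := by
          rw [h2]; field_simp
          linear_combination (u * z.re + (w.re + u ^ 2 * w.re)) * hre +
            (u * z.im + (w.im + u ^ 2 * -w.im)) * him + (1 - u ^ 2) ^ 2 * hsq
        conv_lhs => rw [hvec]
        simp only [Matrix.smul_cons, smul_eq_mul, Matrix.smul_empty, ← e1, ← e2]
        congr 1
        field_simp
      exact Or.inr ⟨(_, u, w.re), ⟨mem_signs_of_smul (realRho_quadratic hu hc) (e ▸ ha),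
        abs_le.1 hu, abs_le.1 hc⟩, e.symm⟩
  · rintro _ (⟨⟨a, b⟩, ⟨ha, hb⟩, rfl⟩ | ⟨⟨s, u, c⟩, ⟨hs, hu, hc⟩, rfl⟩)
    · exact mulCoeffs_mem_sphere ha hb
    · exact smul_mem_sphere (realRho_quadratic (abs_le.2 hu) (abs_le.2 hc)) hs

theorem hasCover_sphere_two : HasCover 2 (sphere 2) := by
  have h := hasCover_signs.prod (hasCover_Icc.prod hasCover_Icc)
  rw [zero_add] at h
  rw [sphere_two]
  refine ((hasCover_sphere_one.prod hasCover_sphere_one).image (contDiff_mulCoeffs 1 1)).union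
    (h.image ?_)
  refine contDiff_pi.2 fun i => ?_
  fin_cases i <;> simp <;> fun_prop

/-- Exponents add under products and survive polynomial maps, so each quadratic factor adds two. -/
theorem hasCover_sphere (J : ℕ) : HasCover J (sphere J) := by
  induction J using Nat.twoStepInduction with
  | zero => exact hasCover_sphere_zero
  | one => exact hasCover_sphere_one
  | more J ih _ =>
    rw [sphere_add_two]
    exact (ih.prod hasCover_sphere_two).image (contDiff_mulCoeffs J 2)

/-! ### Counting integer polynomials by `rho` -/

theorem realUnitStarBody_rho (J : ℕ) :
    realUnitStarBody rho J = {a | realRho (coeffPoly a) ≤ 1} := by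
  ext a
  change rho (coeffPoly fun i => Complex.ofRealHom (a i)) ≤ 1 ↔ realRho (coeffPoly a) ≤ 1
  rw [← coeffPoly_map, realRho]

theorem realRho_coeffPoly_pos {J : ℕ} (a : Fin (J + 1) → ℝ) (ha : a ≠ 0) :
    0 < realRho (coeffPoly a) := by
  refine realRho_pos fun h => ha (coeffPoly_injective (h.trans ?_))
  simp [coeffPoly]

theorem realRho_coeffPoly_smul {J : ℕ} (t : ℝ) (a : Fin (J + 1) → ℝ) :
    realRho (coeffPoly (t • a)) = |t| * realRho (coeffPoly a) := by
  rw [coeffPoly_smul, realRho_C_mul]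

theorem isBounded_realUnitStarBody_rho (J : ℕ) :
    Bornology.IsBounded (realUnitStarBody rho J) := by
  rw [realUnitStarBody_rho]
  exact (isCompact_sublevel_one realRho_coeffPoly_pos realRho_coeffPoly_smul
    (hasCover_sphere J).1).isBounded

/-- The integer polynomials of degree at most `J` and reciprocal Mahler measure at most `t`. -/
def intPolys (J : ℕ) (t : ℝ) : Set ℤ[X] :=
  {g | g.natDegree ≤ J ∧ rho (g.map (Int.castRingHom ℂ)) ≤ t}

theorem realRho_coeffPoly_div {J : ℕ} {t : ℝ} (ht : 0 < t) (z : Fin (J + 1) → ℤ) :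
    realRho (coeffPoly fun i => (z i / t : ℝ)) =
      rho ((coeffPoly z).map (Int.castRingHom ℂ)) / t := by
  have h1 : (fun i => (z i / t : ℝ)) = t⁻¹ • fun i => Int.castRingHom ℝ (z i) := by
    funext i
    simp [div_eq_inv_mul]
  rw [h1, realRho_coeffPoly_smul, ← coeffPoly_map, realRho, Polynomial.map_map,
    abs_of_pos (inv_pos.2 ht), div_eq_inv_mul]
  congr 3

/-- By homogeneity, `rho ≤ t` for an integer vector means that its dilate by `t⁻¹` lies in the star
body. -/
theorem bijOn_coeffPoly (J : ℕ) {t : ℝ} (ht : 0 < t) :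
    Set.BijOn coeffPoly
      {z : Fin (J + 1) → ℤ | (fun i => (z i / t : ℝ)) ∈ realUnitStarBody rho J} (intPolys J t) := by
  have h : ∀ z : Fin (J + 1) → ℤ, (fun i => (z i / t : ℝ)) ∈ realUnitStarBody rho J ↔
      rho ((coeffPoly z).map (Int.castRingHom ℂ)) ≤ t := by
    intro z
    rw [realUnitStarBody_rho]
    change realRho _ ≤ 1 ↔ _
    rw [realRho_coeffPoly_div ht, div_le_one ht]
  refine ⟨fun z hz => ⟨natDegree_coeffPoly_le z, (h z).1 hz⟩, coeffPoly_injective.injOn,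
    fun g hg => ⟨coeffVec J g, ?_, coeffPoly_coeffVec hg.1⟩⟩
  refine (h _).2 ?_
  rw [coeffPoly_coeffVec hg.1]
  exact hg.2

theorem ncard_intPolys (J : ℕ) : ∃ C : ℝ, ∀ t : ℝ, 1 ≤ t →
    |((intPolys J t).ncard : ℝ) - (volume (realUnitStarBody rho J)).toReal * t ^ (J + 1)| ≤
      C * t ^ J := by
  obtain ⟨C, hC⟩ := (hasCover_sphere J).lattice_count (isBounded_realUnitStarBody_rho J)
    (by
      intro Q hQ h1 h2
      rw [realUnitStarBody_rho] at h1 h2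
      exact inter_level_one_nonempty realRho_coeffPoly_pos realRho_coeffPoly_smul
        (hasCover_sphere J).1 hQ h1 h2)
  refine ⟨C, fun t ht => ?_⟩
  rw [← (bijOn_coeffPoly J (by linarith : 0 < t)).ncard_eq]
  simpa using hC t ht

/-! ### Reciprocal integer polynomials -/

theorem finite_recipPolys (N : ℕ) (t : ℝ) : (recipPolys N t).Finite :=
  (finite_mahlerMeasure_le N t.toNNReal).subset fun _ hf => ⟨hf.2.1, hf.2.2.trans (le_max_left _ _)⟩

/-- The reciprocal polynomials of even degree in `recipPolys N t`. -/
def evenRecipPolys (N : ℕ) (t : ℝ) : Set ℤ[X] := {f | f ∈ recipPolys N t ∧ Even f.natDegree}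

theorem natDegree_recipLift {R : Type*} [CommRing R] (g : R[X]) :
    (recipLift g.natDegree g).natDegree = 2 * g.natDegree := by
  by_cases hg : g = 0
  · subst hg
    simp [recipLift]
  refine le_antisymm (natDegree_recipLift_le _ _) (le_natDegree_of_ne_zero ?_)
  rw [← reflect_recipLift, coeff_reflect, revAt_le le_rfl, Nat.sub_self, coeff_zero_recipLift]
  exact leadingCoeff_ne_zero.2 hg

/-- Lifting by the degree of `g` itself, not by a fixed `m`, avoids a spurious factor `X`: the lift
then has degree exactly `2 * g.natDegree` and is reciprocal for its own degree. -/
theorem bijOn_recipLift (N : ℕ) (t : ℝ) :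
    Set.BijOn (fun g : ℤ[X] => recipLift g.natDegree g) (intPolys (N / 2) t)
      (evenRecipPolys N t) := by
  have hrho : ∀ g : ℤ[X], rho (g.map (Int.castRingHom ℂ)) =
      ((recipLift g.natDegree g).map (Int.castRingHom ℂ)).mahlerMeasure := fun g => by
    rw [rho_eq_recipLift natDegree_map_le, recipLift_map]
  refine ⟨fun g hg => ⟨⟨?_, ?_, ?_⟩, ?_⟩, fun g _ h _ hgh => ?_, fun f hf => ?_⟩
  · change reflect _ _ = _
    rw [natDegree_recipLift, reflect_recipLift]
  · have := hg.1
    rw [natDegree_recipLift]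
    omega
  · rw [← hrho]
    exact hg.2
  · rw [natDegree_recipLift]
    exact even_two_mul _
  · have hgh : recipLift g.natDegree g = recipLift h.natDegree h := hgh
    have h1 := congrArg natDegree hgh
    rw [natDegree_recipLift, natDegree_recipLift] at h1
    have h2 : g.natDegree = h.natDegree := by omega
    rw [h2] at hgh
    exact recipLift_injOn h2.le le_rfl hgh
  · obtain ⟨⟨hr, hd, hm⟩, m, hm2⟩ := hf
    rw [← two_mul] at hm2
    have hr' : reflect (2 * m) f = f := by rw [← hm2]; exact hr
    obtain ⟨g, hg, hgf⟩ := exists_eq_recipLift hm2.le hr'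
    have hgm : g.natDegree = m := by
      by_cases hf0 : f = 0
      · rw [hf0, natDegree_zero] at hm2
        omega
      · refine le_antisymm hg (le_natDegree_of_ne_zero ?_)
        have hr'' : f.reverse = f := hr
        rw [← coeff_zero_recipLift, hgf, ← hr'', coeff_zero_reverse]
        exact leadingCoeff_ne_zero.2 hf0
    have hgf' : recipLift g.natDegree g = f := by rw [hgm, hgf]
    refine ⟨g, ⟨by omega, ?_⟩, hgf'⟩
    rw [hrho, hgf']
    exact hm

/-- Evaluating `f(x) = x ^ M * f(1/x)` at `-1` gives `f(-1) = -f(-1)`. -/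
theorem IsReciprocal.isRoot_neg_one {f : ℤ[X]} (hf : IsReciprocal f) (hodd : Odd f.natDegree) :
    f.IsRoot (-1) := by
  let _ : Invertible (-1 : ℤ) := ⟨-1, by norm_num, by norm_num⟩
  have h := eval₂_reverse_mul_pow (RingHom.id ℤ) (-1) f
  have hf' : f.reverse = f := hf
  rw [hf', eval₂_id, eval₂_id, hodd.neg_one_pow] at h
  have h3 : ⅟(-1 : ℤ) = -1 := rfl
  rw [h3] at h
  rw [IsRoot.def]
  omega

theorem reverse_X_add_one : (X + 1 : ℤ[X]).reverse = X + 1 := by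
  have h : (X + 1 : ℤ[X]).natDegree = 1 := natDegree_X_add_C 1
  have hX : reflect 1 (X : ℤ[X]) = 1 := by
    have := reflect_monomial (R := ℤ) 1 1
    rwa [pow_one, revAt_le le_rfl, pow_zero] at this
  rw [reverse, h, reflect_add, hX, reflect_one, pow_one, add_comm]

/-- Zero is removed from the second set because its `natDegree` is `0`, so it already counts as
even. -/
theorem recipPolys_eq (N : ℕ) (hN : 0 < N) (t : ℝ) :
    recipPolys N t =
      evenRecipPolys N t ∪ (fun h => (X + 1) * h) '' (evenRecipPolys (N - 1) t \ {0}) := by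
  have hne : (X + 1 : ℤ[X]) ≠ 0 := X_add_C_ne_zero 1
  have hdeg : ∀ h : ℤ[X], h ≠ 0 → ((X + 1) * h).natDegree = h.natDegree + 1 := by
    intro h hh
    rw [natDegree_mul hne hh, show (X + 1 : ℤ[X]).natDegree = 1 from natDegree_X_add_C 1, add_comm]
  have hmu : ∀ h : ℤ[X], (((X + 1) * h).map (Int.castRingHom ℂ)).mahlerMeasure =
      (h.map (Int.castRingHom ℂ)).mahlerMeasure := by
    intro h
    have h1 : (X + 1 : ℂ[X]).mahlerMeasure = 1 := by
      have := mahlerMeasure_X_add_C 1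
      simpa using this
    rw [Polynomial.map_mul, mahlerMeasure_mul]
    simp [h1]
  refine Set.Subset.antisymm (fun f hf => ?_) (Set.union_subset (fun f hf => hf.1) ?_)
  · rcases Nat.even_or_odd f.natDegree with he | ho
    · exact Or.inl ⟨hf, he⟩
    · obtain ⟨h, rfl⟩ := dvd_iff_isRoot.2 (IsReciprocal.isRoot_neg_one hf.1 ho)
      have e : (X - C (-1) : ℤ[X]) = X + 1 := by simp
      rw [e] at hf ho ⊢
      have hh : h ≠ 0 := by
        rintro rfl
        simp at ho
      obtain ⟨hr, hd, hm⟩ := hf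
      rw [hdeg h hh] at hd ho
      refine Or.inr ⟨h, ⟨⟨⟨?_, by omega, by rwa [hmu] at hm⟩, ?_⟩, hh⟩, rfl⟩
      · have hr : ((X + 1) * h).reverse = (X + 1) * h := hr
        rw [reverse_mul_of_domain, reverse_X_add_one] at hr
        exact mul_left_cancel₀ hne hr
      · rw [Nat.odd_add_one, Nat.not_odd_iff_even] at ho
        exact ho
  · rintro _ ⟨h, ⟨⟨⟨hr, hd, hm⟩, -⟩, hh⟩, rfl⟩
    have hr : h.reverse = h := hr
    refine ⟨?_, ?_, ?_⟩
    · change ((X + 1) * h).reverse = (X + 1) * h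
      rw [reverse_mul_of_domain, reverse_X_add_one, hr]
    · change ((X + 1) * h).natDegree ≤ N
      rw [hdeg h hh]
      omega
    · change (((X + 1) * h).map (Int.castRingHom ℂ)).mahlerMeasure ≤ t
      rwa [hmu]

theorem ncard_recipPolys (N : ℕ) (hN : 0 < N) {t : ℝ} (ht : 0 ≤ t) :
    -- The `+ 1` compensates for the zero polynomial, which both terms on the right count.
    (recipPolys N t).ncard + 1 = (intPolys (N / 2) t).ncard + (intPolys ((N - 1) / 2) t).ncard := by
  have hne : (X + 1 : ℤ[X]) ≠ 0 := X_add_C_ne_zero 1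
  have hfin : ∀ M, (evenRecipPolys M t).Finite := fun M =>
    (finite_recipPolys M t).subset fun f hf => hf.1
  have h0 : (0 : ℤ[X]) ∈ evenRecipPolys (N - 1) t :=
    ⟨⟨reverse_zero, by simp, by simpa using ht⟩, by simp⟩
  have hdisj : Disjoint (evenRecipPolys N t)
      ((fun h => (X + 1) * h) '' (evenRecipPolys (N - 1) t \ {0})) := by
    refine Set.disjoint_left.2 ?_
    rintro _ ⟨-, he⟩ ⟨h, ⟨⟨-, he'⟩, hh⟩, rfl⟩
    rw [natDegree_mul hne hh, show (X + 1 : ℤ[X]).natDegree = 1 from natDegree_X_add_C 1,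
      add_comm, Nat.even_add_one] at he
    exact he he'
  rw [recipPolys_eq N hN, Set.ncard_union_eq hdisj (hfin N) (((hfin _).sdiff).image _),
    Set.ncard_image_of_injective _ (mul_right_injective₀ hne), add_assoc,
    Set.ncard_sdiff_singleton_add_one h0 (hfin _), (bijOn_recipLift N t).ncard_eq,
    (bijOn_recipLift (N - 1) t).ncard_eq]

end ReciprocalMahler

end

theorem theorem10 (N : ℕ) (hN : 0 < N) :
    (∀ t : ℝ, (ReciprocalMahler.recipPolys N t).Finite) ∧
    (∀ J : ℕ, volume (ReciprocalMahler.realUnitStarBody ReciprocalMahler.rho J) ≠ ⊤) ∧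
    (∀ J : ℕ, N = 2 * J →
      (fun t : ℝ => ((ReciprocalMahler.recipPolys N t).ncard : ℝ) -
        (volume (ReciprocalMahler.realUnitStarBody ReciprocalMahler.rho J)).toReal * t ^ (J + 1))
        =O[atTop] fun t : ℝ => t ^ J) ∧
    (∀ J : ℕ, N = 2 * J + 1 →
      (fun t : ℝ => ((ReciprocalMahler.recipPolys N t).ncard : ℝ) -
        2 * (volume (ReciprocalMahler.realUnitStarBody ReciprocalMahler.rho J)).toReal *
          t ^ (J + 1))
        =O[atTop] fun t : ℝ => t ^ J) := by
  refine ⟨ReciprocalMahler.finite_recipPolys N,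
    fun J => (ReciprocalMahler.isBounded_realUnitStarBody_rho J).measure_lt_top.ne,
    fun J hJ => ?_, fun J hJ => ?_⟩
  -- Here the odd degrees contribute `intPolys (J - 1) t`, of size `O(t ^ J)`, which goes into the
  -- error.
  · obtain ⟨K, rfl⟩ : ∃ K, J = K + 1 := ⟨J - 1, by omega⟩
    obtain ⟨C, hC⟩ := ReciprocalMahler.ncard_intPolys (K + 1)
    obtain ⟨D, hD⟩ := ReciprocalMahler.ncard_intPolys K
    set V := (volume (ReciprocalMahler.realUnitStarBody ReciprocalMahler.rho (K + 1))).toReal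
    set W := (volume (ReciprocalMahler.realUnitStarBody ReciprocalMahler.rho K)).toReal
    -- `C` bounds the even-degree error, `W + |D|` the whole odd-degree count, and `1` the zero
    -- polynomial.
    refine IsBigO.of_bound (C + W + |D| + 1) ?_
    filter_upwards [eventually_ge_atTop 1] with t ht
    have ht0 : 0 ≤ t := by linarith
    have h := congrArg (Nat.cast (R := ℝ)) (ReciprocalMahler.ncard_recipPolys N hN ht0)
    rw [show N / 2 = K + 1 by omega, show (N - 1) / 2 = K by omega] at h
    push_cast at h
    have h1 := abs_le.1 (hC t ht)
    have h2 := abs_le.1 (hD t ht)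
    have h3 : t ^ K ≤ t ^ (K + 1) := pow_le_pow_right₀ ht (Nat.le_succ K)
    have h4 : 1 ≤ t ^ (K + 1) := one_le_pow₀ ht
    have h5 : D * t ^ K ≤ |D| * t ^ (K + 1) :=
      mul_le_mul (le_abs_self D) h3 (by positivity) (abs_nonneg D)
    have h6 : 0 ≤ W * t ^ (K + 1) := by positivity
    rw [Real.norm_eq_abs, Real.norm_of_nonneg (by positivity : 0 ≤ t ^ (K + 1)), abs_le]
    constructor <;> nlinarith
  · obtain ⟨C, hC⟩ := ReciprocalMahler.ncard_intPolys J
    -- Both parities now give `intPolys J t`, whence the factor two.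
    refine IsBigO.of_bound (2 * C + 1) ?_
    filter_upwards [eventually_ge_atTop 1] with t ht
    have ht0 : 0 ≤ t := by linarith
    have h := congrArg (Nat.cast (R := ℝ)) (ReciprocalMahler.ncard_recipPolys N hN ht0)
    rw [show N / 2 = J by omega, show (N - 1) / 2 = J by omega] at h
    push_cast at h
    have h1 := abs_le.1 (hC t ht)
    have h4 : 1 ≤ t ^ J := one_le_pow₀ ht
    rw [Real.norm_eq_abs, Real.norm_of_nonneg (by positivity : 0 ≤ t ^ J), abs_le]
    constructor <;> linarith
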